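/- Let $k\ge 1$, $N\ge k$, and let $f_1,\dots,f_N$ be affine forms on $\mathbb R^k$ with zero sets $H_j=\ker f_j$ and linear parts $l_j=f_j-f_j(0)$. Assume that the $H_j$ are in generic position: they are distinct, any $k$ of them meet at a single point, and any $k+1$ of them have empty intersection. Let $\alpha_1,\dots,\alpha_N>0$. Let $\mathcal X$ be the set of vertices of the arrangement; a vertex $X$ is regarded both as a $k$-element subset $\{j_1,\dots,j_k\}$ of $\{1,\dots,N\}$ and as the point $H_{j_1}\cap\dots\cap H_{j_k}$. Let $f_0$ be a linear form on $\mathbb R^k$ that takes distinct values at the vertices and is nonconstant on the intersection line of any $k-1$ of the hyperplanes. Let $\mathcal D^+$ be the set of connected components of $\mathbb R^k\setminus\bigcup_j H_j$ on which $f_0$ is bounded from below. Fix an orientation of $\mathbb R^k$, and for $X=\{j_1,\dots,j_k\}\in\mathcal X$ put $$\omega_X=\frac{df_{j_1}}{f_{j_1}}\wedge\dots\wedge\frac{df_{j_k}}{f_{j_k}},$$ where the elements of $X$ are ordered so that $df_{j_1}\wedge\dots\wedge df_{j_k}$ is positively oriented (if $k=1$, where there is only one ordering, $\omega_X=\pm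 df_{j_1}/f_{j_1}$ with the sign for which $\pm df_{j_1}$ is positively oriented). For $U\subset\{1,\dots,N\}$ with $|U|=k-1$, let $e_U$ be the vector directing the line $L_U=\bigcap_{j\in U}H_j$ (with $L_\emptyset=\mathbb R$ if $k=1$), normalized by $f_0(e_U)=1$. Then for every $\Delta\in\mathcal D^+$ and every $\lambda\in\mathbb C$ with $\operatorname{Re}\lambda>0$ the integrals $$I_{\Delta,X}(\lambda)=\int_\Delta e^{-\lambda f_0}\Big(\prod_{j=1}^N|f_j|^{\alpha_j}\Big)\,\omega_X,\qquad X\in\mathcal X,$$ converge absolutely, and the vector $I_\Delta(\lambda)=(I_{\Delta,X}(\lambda))_{X\in\mathcal X}$ is complex differentiable on $\{\operatorname{Re}\lambda>0\}$ and satisfies $$I_\Delta'=-\Big(\mathcal A+\frac1\lambda\mathcal B\Big)I_\Delta .$$ Here $\mathcal A$ is the diagonal matrix with $\mathcal A_{X,X}=f_0(X)$, and $\mathcal B$ is given by $\mathcal B_{X,X}=\sum_{j\in X}\alpha_j$; by $\mathcal B_{X,Y}=\operatorname{sgn}\big(l_j(e_U)\,l_r(e_U)\big)\,\alpha_r$ if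 $|X\cap Y|=k-1$, where $\{j\}=X\setminus Y$, $\{r\}=Y\setminus X$ and $U=X\cap Y$; and by $\mathcal B_{X,Y}=0$ if $|X\cap Y|<k-1$. -/

import Mathlib

open scoped BigOperators

noncomputable section

namespace HyperplaneIntegrals

/-- The space `ℝ^k`. -/
abbrev Space (k : ℕ) : Type := EuclideanSpace ℝ (Fin k)

/-- Vertices of a generic arrangement of `N` hyperplanes in `ℝ^k`, as `k`-element sets of indices. -/
abbrev Vertex (N k : ℕ) : Type := {X : Finset (Fin N) // X.card = k}

/-- The hyperplane `H_j = ker f_j`. -/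
def hyperplane {N k : ℕ} (f : Fin N → Space k →ᵃ[ℝ] ℝ) (j : Fin N) : Set (Space k) :=
  {z | f j z = 0}

/-- The intersection of the hyperplanes `H_j`, `j ∈ U`. -/
def flat {N k : ℕ} (f : Fin N → Space k →ᵃ[ℝ] ℝ) (U : Finset (Fin N)) : Set (Space k) :=
  {z | ∀ j ∈ U, z ∈ hyperplane f j}

/-- The hyperplanes are in generic position: they are distinct, any `k` of them meet at a
single point and any `k + 1` of them have empty intersection. -/
structure IsGeneric {N k : ℕ} (f : Fin N → Space k →ᵃ[ℝ] ℝ) : Prop where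
  distinct : Function.Injective (hyperplane f)
  vertex : ∀ X : Finset (Fin N), X.card = k → ∃ z, flat f X = {z}
  empty : ∀ S : Finset (Fin N), S.card = k + 1 → flat f S = ∅

/-- The vertex `X`, as the point of `ℝ^k` that is the intersection of the `H_j`, `j ∈ X`. -/
def vertexPoint {N k : ℕ} (f : Fin N → Space k →ᵃ[ℝ] ℝ) (X : Vertex N k) : Space k :=
  Classical.epsilon fun z => flat f X.1 = {z}

/-- The linear form `f₀` is in general position with respect to the arrangement: it takes
distinct values at the vertices and is nonconstant on the intersection of any `k - 1` of the
hyperplanes. -/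
structure IsGenericForm {N k : ℕ} (f : Fin N → Space k →ᵃ[ℝ] ℝ) (f₀ : Space k →ₗ[ℝ] ℝ) :
    Prop where
  distinct : Function.Injective fun X : Vertex N k => f₀ (vertexPoint f X)
  nonconstant : ∀ U : Finset (Fin N), U.card + 1 = k →
    ∃ z ∈ flat f U, ∃ w ∈ flat f U, f₀ z ≠ f₀ w

/-- The complement of the union of the hyperplanes. -/
def arrangementCompl {N k : ℕ} (f : Fin N → Space k →ᵃ[ℝ] ℝ) : Set (Space k) :=
  (⋃ j, hyperplane f j)ᶜ

/-- The arrangement domains: connected components of the complement of the hyperplanes. -/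
def domains {N k : ℕ} (f : Fin N → Space k →ᵃ[ℝ] ℝ) : Set (Set (Space k)) :=
  {Δ | ∃ x ∈ arrangementCompl f, Δ = connectedComponentIn (arrangementCompl f) x}

/-- The arrangement domains on which `f₀` is bounded from below. -/
def domainsPlus {N k : ℕ} (f : Fin N → Space k →ᵃ[ℝ] ℝ) (f₀ : Space k →ₗ[ℝ] ℝ) :
    Set (Set (Space k)) :=
  {Δ | Δ ∈ domains f ∧ BddBelow (f₀ '' Δ)}

/-- The exterior product `φ₁ ∧ ⋯ ∧ φ_k`, that is `(v₁, …, v_k) ↦ det (φ_j (v_i))`. -/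
def wedge {k : ℕ} (φ : Fin k → Space k →ₗ[ℝ] ℝ) : Space k [⋀^Fin k]→ₗ[ℝ] ℝ :=
  (Matrix.detRowAlternating (n := Fin k) (R := ℝ)).compLinearMap (LinearMap.pi φ)

open Classical in
/-- The coefficient of a `k`-form with respect to the Euclidean volume form of the oriented
space `(ℝ^k, o)`: its value on the standard basis, with a minus sign if the standard basis is
negatively oriented. The form is positively oriented when this is positive. -/
def orientedCoeff {k : ℕ} (o : Orientation ℝ (Space k) (Fin k))
    (η : Space k [⋀^Fin k]→ₗ[ℝ] ℝ) : ℝ :=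
  (if (EuclideanSpace.basisFun (Fin k) ℝ).toBasis.orientation = o then 1 else -1) *
    η (EuclideanSpace.basisFun (Fin k) ℝ)

open Classical in
/-- The one of the two forms `η`, `-η` that is positively oriented (if `η ≠ 0`). -/
def posOriented {k : ℕ} (o : Orientation ℝ (Space k) (Fin k))
    (η : Space k [⋀^Fin k]→ₗ[ℝ] ℝ) : Space k [⋀^Fin k]→ₗ[ℝ] ℝ :=
  if 0 < orientedCoeff o η then η else -η

/-- The form `ω_X = df_{j₁}/f_{j₁} ∧ ⋯ ∧ df_{j_k}/f_{j_k}` at the point `z`, with the sign for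
which `df_{j₁} ∧ ⋯ ∧ df_{j_k}` is positively oriented. By `vertexForm_eq`, this is the form
obtained from any ordering of `X` for which `df_{j₁} ∧ ⋯ ∧ df_{j_k}` is positively oriented. -/
def vertexForm {N k : ℕ} (o : Orientation ℝ (Space k) (Fin k)) (f : Fin N → Space k →ᵃ[ℝ] ℝ)
    (X : Vertex N k) (z : Space k) : Space k [⋀^Fin k]→ₗ[ℝ] ℝ :=
  (∏ j ∈ X.1, f j z)⁻¹ • posOriented o (wedge fun i => (f (X.1.orderEmbOfFin X.2 i)).linear)

theorem wedge_perm {k : ℕ} (φ : Fin k → Space k →ₗ[ℝ] ℝ) (σ : Equiv.Perm (Fin k)) :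
    wedge (fun i => φ (σ i)) = (((Equiv.Perm.sign σ : ℤˣ) : ℤ) : ℝ) • wedge φ := by
  ext v
  exact Matrix.det_permute' σ (Matrix.of fun i j => φ j (v i))

theorem orientedCoeff_neg {k : ℕ} (o : Orientation ℝ (Space k) (Fin k))
    (η : Space k [⋀^Fin k]→ₗ[ℝ] ℝ) : orientedCoeff o (-η) = -orientedCoeff o η := by
  simp [orientedCoeff]

theorem vertexForm_eq {N k : ℕ} (o : Orientation ℝ (Space k) (Fin k))
    (f : Fin N → Space k →ᵃ[ℝ] ℝ) (X : Vertex N k) (z : Space k) (e : Fin k ≃ X.1)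
    (he : 0 < orientedCoeff o (wedge fun i => (f (e i)).linear)) :
    vertexForm o f X z = (∏ j ∈ X.1, f j z)⁻¹ • wedge fun i => (f (e i)).linear := by
  unfold vertexForm
  congr 1
  set e₀ : Fin k ≃ X.1 := (X.1.orderIsoOfFin X.2).toEquiv
  have h := wedge_perm (fun i => (f (e₀ i)).linear) (e.trans e₀.symm)
  simp only [Equiv.trans_apply, Equiv.apply_symm_apply] at h
  have h₀ : (fun i => (f (X.1.orderEmbOfFin X.2 i)).linear) = fun i => (f (e₀ i)).linear := rfl
  rw [h₀]
  rw [h] at he ⊢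
  rcases Int.units_eq_one_or (Equiv.Perm.sign (e.trans e₀.symm)) with hs | hs
  · simp only [hs, Units.val_one, Int.cast_one, one_smul] at he ⊢
    simp [posOriented, he]
  · have hn : ∀ η : Space k [⋀^Fin k]→ₗ[ℝ] ℝ, (-1 : ℝ) • η = -η := by
      intro η
      ext v
      simp
    simp only [hs, Units.val_neg, Units.val_one, Int.cast_neg, Int.cast_one, hn] at he ⊢
    rw [orientedCoeff_neg] at he
    rw [posOriented, if_neg (by linarith)]

/-- The coefficient of `e^{-λ f₀} Ω_X`, `Ω_X = (∏ |f_j|^{α_j}) ω_X`, with respect to the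
volume form of `(ℝ^k, o)`. -/
def integrand {N k : ℕ} (o : Orientation ℝ (Space k) (Fin k)) (f : Fin N → Space k →ᵃ[ℝ] ℝ)
    (f₀ : Space k →ₗ[ℝ] ℝ) (α : Fin N → ℝ) (X : Vertex N k) (lam : ℂ) (z : Space k) : ℂ :=
  Complex.exp (-lam * (f₀ z : ℂ)) *
    (((∏ j, |f j z| ^ α j) * orientedCoeff o (vertexForm o f X z) : ℝ) : ℂ)

/-- The vector `I_Δ(λ)` of the integrals `I_{Δ,X}(λ) = ∫_Δ e^{-λ f₀} Ω_X`. -/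
def integralVec {N k : ℕ} (o : Orientation ℝ (Space k) (Fin k)) (f : Fin N → Space k →ᵃ[ℝ] ℝ)
    (f₀ : Space k →ₗ[ℝ] ℝ) (α : Fin N → ℝ) (Δ : Set (Space k)) (lam : ℂ) : Vertex N k → ℂ :=
  fun X => ∫ z in Δ, integrand o f f₀ α X lam z

/-- The vector `e_U` directing the line `L_U`, normalized by `f₀(e_U) = 1`. -/
def edgeVector {N k : ℕ} (f : Fin N → Space k →ᵃ[ℝ] ℝ) (f₀ : Space k →ₗ[ℝ] ℝ)
    (U : Finset (Fin N)) : Space k :=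
  Classical.epsilon fun e =>
    (∃ p, flat f U = Set.range fun t : ℝ => p + t • e) ∧ f₀ e = 1

/-- The relative orientation `ε(j,r,U) = sgn (l_j(e_U) l_r(e_U))`. -/
def relSign {N k : ℕ} (f : Fin N → Space k →ᵃ[ℝ] ℝ) (f₀ : Space k →ₗ[ℝ] ℝ)
    (j r : Fin N) (U : Finset (Fin N)) : ℝ :=
  Real.sign ((f j).linear (edgeVector f f₀ U) * (f r).linear (edgeVector f f₀ U))

/-- The diagonal matrix with entries `f₀(X)`. -/
def matA {N k : ℕ} (f : Fin N → Space k →ᵃ[ℝ] ℝ) (f₀ : Space k →ₗ[ℝ] ℝ) :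
    Matrix (Vertex N k) (Vertex N k) ℝ :=
  Matrix.diagonal fun X => f₀ (vertexPoint f X)

/-- The matrix `B`. When `|X ∩ Y| = k - 1`, both sums run over one-element sets
`X \ Y = {j}` and `Y \ X = {r}`. -/
def matB {N k : ℕ} (f : Fin N → Space k →ᵃ[ℝ] ℝ) (f₀ : Space k →ₗ[ℝ] ℝ) (α : Fin N → ℝ) :
    Matrix (Vertex N k) (Vertex N k) ℝ :=
  Matrix.of fun X Y =>
    if X = Y then ∑ j ∈ X.1, α j
    else if (X.1 ∩ Y.1).card + 1 = k then
      ∑ j ∈ X.1 \ Y.1, ∑ r ∈ Y.1 \ X.1, relSign f f₀ j r (X.1 ∩ Y.1) * α r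
    else 0

end HyperplaneIntegrals

end

/-!
A domain `Δ` is an open polyhedron `{s_j f_j > 0}` with signs `s_j`. Since `f₀` is bounded below
on `Δ` and nonconstant on every edge line, it grows linearly there in all directions, so that
`e^{-λ f₀}` makes the integrals converge, and one may differentiate under the integral sign. This
puts a factor `-f₀` into `I_{Δ,X}`. With `U_j = X \ {j}` one has
`f₀ = f₀(X) + ∑_{j ∈ X} f_j / l_j(e_{U_j})`, and the factor `f_j` cancels against the denominator
of `ω_X`, leaving a density whose denominator is the product over `U_j`. Integrating this density
by parts along `e_{U_j}`, where `f₀` has slope one, expresses `λ` times its integral by the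
integrals belonging to the vertices `U_j ∪ {r}`, with coefficients `α_r l_r(e_{U_j})`. The volume
forms of `X` and `U_j ∪ {r}` are in the ratio `|l_j(e_{U_j})| : |l_r(e_{U_j})|`, so that only the
sign of `l_j(e_{U_j}) l_r(e_{U_j})` survives in the matrix entry.
-/

noncomputable section

namespace HyperplaneIntegrals

open MeasureTheory

section Polyhedron

variable {V ι : Type*} [NormedAddCommGroup V] [NormedSpace ℝ V]

/-- The open polyhedron cut out by the inequalities `0 < g j`. -/
def polyhedron (g : ι → V →ᵃ[ℝ] ℝ) : Set V :=
  {z | ∀ j, 0 < g j z}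

/-- `φ` grows on the polyhedron of `g` at least as fast as the distances to its walls: this is what
makes `e ^ (-φ)` integrable against products of powers of the `g j`. -/
def Dominates [Fintype ι] (φ : V →ₗ[ℝ] ℝ) (g : ι → V →ᵃ[ℝ] ℝ) : Prop :=
  ∃ c K : ℝ, 0 < c ∧ ∀ z ∈ polyhedron g, c * ∑ j, g j z ≤ φ z + K

theorem affine_add_smul (g : V →ᵃ[ℝ] ℝ) (z v : V) (t : ℝ) :
    g (z + t • v) = g z + t * g.linear v := by
  rw [add_comm, ← vadd_eq_add, g.map_vadd, map_smul, vadd_eq_add, smul_eq_mul, add_comm]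

theorem nonneg_of_bddBelow_polyhedron {g : ι → V →ᵃ[ℝ] ℝ} {φ : V →ₗ[ℝ] ℝ}
    (hne : (polyhedron g).Nonempty) (hb : BddBelow (φ '' polyhedron g)) {v : V}
    (hv : ∀ j, 0 ≤ (g j).linear v) : 0 ≤ φ v := by
  obtain ⟨z, hz⟩ := hne
  obtain ⟨b, hb⟩ := hb
  by_contra! hφv
  obtain ⟨n, hn⟩ := exists_nat_gt ((b - φ z) / φ v)
  have hray : z + (n : ℝ) • v ∈ polyhedron g := fun j => by
    rw [affine_add_smul]
    exact add_pos_of_pos_of_nonneg (hz j) (mul_nonneg n.cast_nonneg (hv j))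
  have := hb (Set.mem_image_of_mem φ hray)
  rw [map_add, map_smul, smul_eq_mul] at this
  rw [div_lt_iff_of_neg hφv] at hn
  linarith

theorem eq_zero_of_vanish_on_face [Finite ι] {l : ι → V →ₗ[ℝ] ℝ} {φ : V →ₗ[ℝ] ℝ}
    (hφ : ∀ v, (∀ j, 0 ≤ l j v) → 0 ≤ φ v) {v w : V} (hv : ∀ j, 0 ≤ l j v) (hφv : φ v = 0)
    (hw : ∀ j, l j v = 0 → l j w = 0) : φ w = 0 := by
  have nonneg_on_face : ∀ u : V, (∀ j, l j v = 0 → l j u = 0) → 0 ≤ φ u := by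
    intro u hu
    have hnear : ∀ᶠ t in nhdsWithin (0 : ℝ) (Set.Ioi 0), ∀ j, 0 ≤ l j v + t * l j u := by
      refine Filter.eventually_all.2 fun j => ?_
      rcases (hv j).eq_or_lt with hj | hj
      · simp [← hj, hu j hj.symm]
      · have hcont : Continuous fun t : ℝ => l j v + t * l j u := by fun_prop
        have hpos := (hcont.continuousAt (x := 0)).eventually_const_lt (by simpa using hj)
        exact (hpos.filter_mono nhdsWithin_le_nhds).mono fun t ht => ht.le
    obtain ⟨t, ht, ht0⟩ := (hnear.and self_mem_nhdsWithin).exists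
    have := hφ (v + t • u) fun j => by simpa using ht j
    rw [map_add, map_smul, hφv, zero_add, smul_eq_mul] at this
    exact nonneg_of_mul_nonneg_right this ht0
  refine le_antisymm ?_ (nonneg_on_face w hw)
  simpa using nonneg_on_face (-w) fun j hj => by simp [hw j hj]

theorem exists_mul_norm_le_of_homogeneous [FiniteDimensional ℝ V] {m : V → ℝ}
    (hm : Continuous m) (hhom : ∀ t : ℝ, 0 < t → ∀ v, m (t • v) = t * m v)
    (hpos : ∀ v ≠ 0, 0 < m v) :
    ∃ c : ℝ, 0 < c ∧ ∀ v, c * ‖v‖ ≤ m v := by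
  have := FiniteDimensional.proper ℝ V
  obtain ⟨c, hc, hcm⟩ : ∃ c : ℝ, 0 < c ∧ ∀ u ∈ Metric.sphere (0 : V) 1, c ≤ m u := by
    rcases (Metric.sphere (0 : V) 1).eq_empty_or_nonempty with h | h
    · exact ⟨1, one_pos, by simp [h]⟩
    · obtain ⟨u, hu, hmin⟩ := (isCompact_sphere (0 : V) 1).exists_isMinOn h hm.continuousOn
      exact ⟨m u, hpos u (ne_zero_of_mem_unit_sphere ⟨u, hu⟩), fun w hw => hmin hw⟩
  refine ⟨c, hc, fun v => ?_⟩
  rcases eq_or_ne v 0 with rfl | hv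
  · have := hhom 2 two_pos 0
    rw [smul_zero] at this
    rw [norm_zero]
    linarith
  · have hmem : ‖v‖⁻¹ • v ∈ Metric.sphere (0 : V) 1 := by simp [norm_smul, hv]
    calc c * ‖v‖ ≤ m (‖v‖⁻¹ • v) * ‖v‖ := by gcongr; exact hcm _ hmem
      _ = m v := by
        rw [hhom _ (by positivity)]
        field_simp

variable [FiniteDimensional ℝ V]

theorem exists_mul_norm_le_add [Finite ι] {g : ι → V →ᵃ[ℝ] ℝ} {φ : V →ₗ[ℝ] ℝ}
    (hb : BddBelow (φ '' polyhedron g))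
    (hφ : ∀ v ≠ 0, (∀ j, 0 ≤ (g j).linear v) → 0 < φ v) :
    ∃ c K : ℝ, 0 < c ∧ ∀ z ∈ polyhedron g, c * ‖z‖ ≤ φ z + K := by
  have := Fintype.ofFinite ι
  set defect : V → ℝ := fun v => ∑ j, max 0 (-(g j).linear v)
  have hφc : Continuous φ := φ.continuous_of_finiteDimensional
  have hgc : ∀ j, Continuous (g j).linear := fun j => (g j).linear.continuous_of_finiteDimensional
  have hhom : ∀ t : ℝ, 0 < t → ∀ v,
      max (φ (t • v)) (defect (t • v)) = t * max (φ v) (defect v) := fun t ht v => by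
    simp only [defect, map_smul, smul_eq_mul, ← mul_neg, Finset.mul_sum,
      mul_max_of_nonneg _ _ ht.le, mul_zero]
  have hpos : ∀ v ≠ 0, 0 < max (φ v) (defect v) := fun v hv => by
    by_cases hv0 : ∀ j, 0 ≤ (g j).linear v
    · exact lt_max_of_lt_left (hφ v hv hv0)
    · push Not at hv0
      obtain ⟨j, hj⟩ := hv0
      exact lt_max_of_lt_right (Finset.sum_pos' (fun i _ => le_max_left _ _)
        ⟨j, Finset.mem_univ j, lt_max_of_lt_right (neg_pos.2 hj)⟩)
  obtain ⟨c, hc, hcoer⟩ := exists_mul_norm_le_of_homogeneous (by fun_prop) hhom hpos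
  obtain ⟨b, hb⟩ := hb
  refine ⟨c, |b| + ∑ j, |g j 0|, hc, fun z hz => (hcoer z).trans (max_le ?_ ?_)⟩
  · have : (0 : ℝ) ≤ ∑ j, |g j 0| := by positivity
    linarith [abs_nonneg b]
  · have hdefect_le : defect z ≤ ∑ j, |g j 0| := Finset.sum_le_sum fun j _ => by
      have hgz : g j z = g j 0 + (g j).linear z := by simpa using affine_add_smul (g j) 0 z 1
      exact max_le (abs_nonneg _) (by linarith [hz j, le_abs_self (g j 0)])
    linarith [hb (Set.mem_image_of_mem φ hz), neg_abs_le b]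

theorem dominates_of_bddBelow [Fintype ι] {g : ι → V →ᵃ[ℝ] ℝ} {φ : V →ₗ[ℝ] ℝ}
    (hne : (polyhedron g).Nonempty) (hb : BddBelow (φ '' polyhedron g))
    (hφ : ∀ v ≠ 0, ∃ w, (∀ j, (g j).linear v = 0 → (g j).linear w = 0) ∧ φ w ≠ 0) :
    Dominates φ g := by
  have hnonneg : ∀ v, (∀ j, 0 ≤ (g j).linear v) → 0 ≤ φ v :=
    fun v => nonneg_of_bddBelow_polyhedron hne hb
  obtain ⟨c, K, hc, hcoer⟩ := exists_mul_norm_le_add hb fun v hv hv0 => by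
    obtain ⟨w, hw, hφw⟩ := hφ v hv
    exact (hnonneg v hv0).lt_of_ne'
      fun h => hφw (eq_zero_of_vanish_on_face hnonneg hv0 h hw)
  set l : V →L[ℝ] ℝ := (∑ j, (g j).linear).toContinuousLinearMap
  have hsum : ∀ z, ∑ j, g j z ≤ (‖l‖ + 1) * ‖z‖ + ∑ j, g j 0 := fun z => by
    have hgz : ∑ j, g j z = ∑ j, g j 0 + l z := by
      simp only [l, LinearMap.coe_toContinuousLinearMap', LinearMap.sum_apply,
        ← Finset.sum_add_distrib]
      exact Finset.sum_congr rfl fun j _ => by simpa using affine_add_smul (g j) 0 z 1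
    linarith [(le_abs_self _).trans (l.le_opNorm z), norm_nonneg z]
  refine ⟨c / (‖l‖ + 1), K + c / (‖l‖ + 1) * ∑ j, g j 0, by positivity, fun z hz => ?_⟩
  calc c / (‖l‖ + 1) * ∑ j, g j z
      ≤ c / (‖l‖ + 1) * ((‖l‖ + 1) * ‖z‖ + ∑ j, g j 0) := by gcongr; exact hsum z
    _ = c * ‖z‖ + c / (‖l‖ + 1) * ∑ j, g j 0 := by field_simp
    _ ≤ φ z + (K + c / (‖l‖ + 1) * ∑ j, g j 0) := by linarith [hcoer z hz]

end Polyhedron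

section TruncPow

/-- The power function `t ^ β` on the positive half-line, extended by zero. Products of such
functions vanish off a polyhedron, so that integrals over it become integrals over the space. -/
def truncPow (β t : ℝ) : ℝ :=
  if 0 < t then t ^ β else 0

theorem truncPow_of_pos {t : ℝ} (ht : 0 < t) (β : ℝ) : truncPow β t = t ^ β := if_pos ht

theorem truncPow_of_nonpos {t : ℝ} (ht : t ≤ 0) (β : ℝ) : truncPow β t = 0 := if_neg ht.not_gt

theorem truncPow_nonneg (β t : ℝ) : 0 ≤ truncPow β t := by
  unfold truncPow
  split_ifs <;> positivity

theorem measurable_truncPow (β : ℝ) : Measurable (truncPow β) :=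
  Measurable.ite measurableSet_Ioi (by fun_prop) measurable_const

theorem mul_truncPow_sub_one (β t : ℝ) : t * truncPow (β - 1) t = truncPow β t := by
  rcases lt_or_ge 0 t with ht | ht
  · rw [truncPow_of_pos ht, truncPow_of_pos ht, Real.rpow_sub_one ht.ne', mul_div_cancel₀ _ ht.ne']
  · rw [truncPow_of_nonpos ht, truncPow_of_nonpos ht, mul_zero]

theorem continuous_truncPow {β : ℝ} (hβ : 0 < β) : Continuous (truncPow β) := by
  have : truncPow β = fun t => max t 0 ^ β := by
    ext t
    rcases lt_or_ge 0 t with ht | ht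
    · rw [truncPow_of_pos ht, max_eq_left ht.le]
    · rw [truncPow_of_nonpos ht, max_eq_right ht, Real.zero_rpow hβ.ne']
  rw [this]
  exact (continuous_id.max continuous_const).rpow_const fun _ => Or.inr hβ.le

theorem hasDerivAt_truncPow (β : ℝ) {t : ℝ} (ht : t ≠ 0) :
    HasDerivAt (truncPow β) (β * truncPow (β - 1) t) t := by
  rcases ht.lt_or_gt with ht | ht
  · rw [truncPow_of_nonpos ht.le, mul_zero]
    refine (hasDerivAt_const t (0 : ℝ)).congr_of_eventuallyEq ?_
    filter_upwards [eventually_lt_nhds ht] with s hs using truncPow_of_nonpos hs.le β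
  · rw [truncPow_of_pos ht]
    refine (Real.hasDerivAt_rpow_const (Or.inl ht.ne')).congr_of_eventuallyEq ?_
    filter_upwards [eventually_gt_nhds ht] with s hs using truncPow_of_pos hs β

theorem exists_truncPow_mul_exp_le {β δ : ℝ} (hβ : 0 ≤ β) (hδ : 0 < δ) :
    ∃ C : ℝ, ∀ t, truncPow β t * Real.exp (-δ * t) ≤ C := by
  refine ⟨(β / δ) ^ β, fun t => ?_⟩
  rcases lt_or_ge 0 t with ht | ht
  · have hmax := ProbabilityTheory.rpow_abs_le_mul_max_exp_of_pos t hβ hδ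
    rw [abs_of_pos ht, max_eq_left (Real.exp_le_exp.2 (by nlinarith))] at hmax
    calc truncPow β t * Real.exp (-δ * t)
        ≤ (β / δ) ^ β * Real.exp (δ * t) * Real.exp (-δ * t) := by
          rw [truncPow_of_pos ht]; gcongr
      _ = (β / δ) ^ β := by rw [mul_assoc, ← Real.exp_add]; simp
  · rw [truncPow_of_nonpos ht, zero_mul]
    positivity

theorem integrable_truncPow_mul_exp {β δ : ℝ} (hβ : -1 < β) (hδ : 0 < δ) :
    Integrable fun t => truncPow β t * Real.exp (-δ * t) := by
  have hI : (fun t => truncPow β t * Real.exp (-δ * t)) =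
      (Set.Ioi (0 : ℝ)).indicator fun t => t ^ β * Real.exp (-δ * t) := by
    ext t
    simp only [truncPow, Set.indicator_apply, Set.mem_Ioi, ite_mul, zero_mul]
  rw [hI, integrable_indicator_iff measurableSet_Ioi]
  simpa using integrableOn_rpow_mul_exp_neg_mul_rpow hβ one_pos hδ

end TruncPow

section Integrability

variable {V ι : Type*} [NormedAddCommGroup V] [NormedSpace ℝ V] [Fintype ι]

/-- The density `∏ g_j ^ β_j` on the polyhedron of `g`, extended by zero. -/
def weight (g : ι → V →ᵃ[ℝ] ℝ) (β : ι → ℝ) (z : V) : ℝ :=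
  ∏ j, truncPow (β j) (g j z)

theorem weight_nonneg (g : ι → V →ᵃ[ℝ] ℝ) (β : ι → ℝ) (z : V) : 0 ≤ weight g β z :=
  Finset.prod_nonneg fun _ _ => truncPow_nonneg _ _

theorem weight_of_mem_polyhedron {g : ι → V →ᵃ[ℝ] ℝ} (β : ι → ℝ) {z : V}
    (hz : z ∈ polyhedron g) : weight g β z = ∏ j, g j z ^ β j :=
  Finset.prod_congr rfl fun j _ => truncPow_of_pos (hz j) _

theorem weight_of_notMem_polyhedron {g : ι → V →ᵃ[ℝ] ℝ} (β : ι → ℝ) {z : V}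
    (hz : z ∉ polyhedron g) : weight g β z = 0 := by
  obtain ⟨j, hj⟩ := not_forall.1 hz
  exact Finset.prod_eq_zero (Finset.mem_univ j) (truncPow_of_nonpos (not_lt.1 hj) _)

theorem weight_update [DecidableEq ι] (g : ι → V →ᵃ[ℝ] ℝ) (β : ι → ℝ) (r : ι) (b : ℝ) (z : V) :
    weight g (Function.update β r b) z =
      truncPow b (g r z) * ∏ j ∈ Finset.univ.erase r, truncPow (β j) (g j z) := by
  rw [weight, ← Finset.mul_prod_erase _ _ (Finset.mem_univ r), Function.update_self]
  congr 1
  exact Finset.prod_congr rfl fun j hj => by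
    rw [Function.update_of_ne (Finset.ne_of_mem_erase hj)]

theorem mul_weight_update_sub_one [DecidableEq ι] (g : ι → V →ᵃ[ℝ] ℝ) (β : ι → ℝ) (r : ι)
    (z : V) :
    g r z * weight g (Function.update β r (β r - 1)) z = weight g β z := by
  rw [weight_update, ← mul_assoc, mul_truncPow_sub_one,
    Finset.mul_prod_erase _ (fun j => truncPow (β j) (g j z)) (Finset.mem_univ r), weight]

/-- The hyperplanes `g j = 0`, `j ∈ X`, meet at a single point and their number is the
dimension. -/
structure IsSimpleVertex (g : ι → V →ᵃ[ℝ] ℝ) (X : Finset ι) : Prop where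
  card_eq : X.card = Module.finrank ℝ V
  eq_zero : ∀ v, (∀ j ∈ X, (g j).linear v = 0) → v = 0

/-- The function `e ^ (-λ φ) ∏ g_j ^ β_j` on the polyhedron of `g`, extended by zero. -/
def expWeight (g : ι → V →ᵃ[ℝ] ℝ) (φ : V →ₗ[ℝ] ℝ) (β : ι → ℝ) (lam : ℂ) (z : V) : ℂ :=
  Complex.exp (-lam * φ z) * weight g β z

theorem norm_expWeight (g : ι → V →ᵃ[ℝ] ℝ) (φ : V →ₗ[ℝ] ℝ) (β : ι → ℝ) (lam : ℂ) (z : V) :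
    ‖expWeight g φ β lam z‖ = Real.exp (-(lam.re * φ z)) * weight g β z := by
  rw [expWeight, norm_mul, Complex.norm_exp, Complex.norm_real,
    Real.norm_of_nonneg (weight_nonneg g β z)]
  simp

variable [FiniteDimensional ℝ V] [MeasurableSpace V] [BorelSpace V]

theorem measurable_weight (g : ι → V →ᵃ[ℝ] ℝ) (β : ι → ℝ) : Measurable (weight g β) :=
  Finset.measurable_prod _ fun j _ =>
    (measurable_truncPow (β j)).comp (g j).continuous_of_finiteDimensional.measurable

variable (μ : Measure V) [μ.IsAddHaarMeasure]

theorem integrable_comp_affineCoords {E : Type*} [NormedAddCommGroup E]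
    {g : ι → V →ᵃ[ℝ] ℝ} (hcard : Fintype.card ι = Module.finrank ℝ V)
    (hker : ∀ v, (∀ j, (g j).linear v = 0) → v = 0) {F : (ι → ℝ) → E} (hF : Integrable F) :
    Integrable (fun z => F fun j => g j z) μ := by
  set T : V →ₗ[ℝ] (ι → ℝ) := LinearMap.pi fun j => (g j).linear
  have hT : Function.Injective T :=
    (injective_iff_map_eq_zero T).2 fun v hv => hker v fun j => congrFun hv j
  set L : V ≃L[ℝ] (ι → ℝ) :=
    (LinearEquiv.ofInjectiveOfFinrankEq T hT (by simp [hcard])).toContinuousLinearEquiv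
  have hgL : (fun z => F fun j => g j z) = (fun y => F (y + fun j => g j 0)) ∘ L :=
    funext fun z => congrArg F (funext fun j => congrFun (g j).decomp z)
  have := L.isAddHaarMeasure_map μ
  have hshift : Integrable (fun y => F (y + fun j => g j 0)) (μ.map L) := by
    rw [Measure.isAddLeftInvariant_eq_smul (μ.map L) volume]
    exact (hF.comp_add_right _).smul_measure_nnreal
  rw [hgL]
  exact (integrable_map_equiv L.toHomeomorph.toMeasurableEquiv _).1 hshift

theorem integrable_prod_truncPow_mul_exp {g : ι → V →ᵃ[ℝ] ℝ} {X : Finset ι}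
    (hX : IsSimpleVertex g X)
    {β : ι → ℝ} (hβX : ∀ j ∈ X, -1 < β j) (hβ : ∀ j ∉ X, 0 ≤ β j) {δ : ℝ} (hδ : 0 < δ) :
    Integrable (fun z => ∏ j, truncPow (β j) (g j z) * Real.exp (-δ * g j z)) μ := by
  classical
  have hcoords : Integrable (fun z => ∏ j : X, truncPow (β j) (g j z) * Real.exp (-δ * g j z)) μ :=
    integrable_comp_affineCoords μ (g := fun j : X => g j) (by simp [hX.card_eq])
      (fun v hv => hX.eq_zero v fun j hj => hv ⟨j, hj⟩)
      (Integrable.fintype_prod fun j : X => integrable_truncPow_mul_exp (hβX j j.2) hδ)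
  have hbound : ∀ j, ∃ C : ℝ, j ∉ X → ∀ t, truncPow (β j) t * Real.exp (-δ * t) ≤ C := fun j => by
    by_cases hj : j ∈ X
    · exact ⟨0, fun h => absurd hj h⟩
    · obtain ⟨C, hC⟩ := exists_truncPow_mul_exp_le (hβ j hj) hδ
      exact ⟨C, fun _ => hC⟩
  choose C hC using hbound
  have hfac : ∀ j t, 0 ≤ truncPow (β j) t * Real.exp (-δ * t) := fun j t =>
    mul_nonneg (truncPow_nonneg _ _) (Real.exp_pos _).le
  have hsplit := hcoords.bdd_mul (c := ∏ j ∈ Xᶜ, C j)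
    (f := fun z => ∏ j ∈ Xᶜ, truncPow (β j) (g j z) * Real.exp (-δ * g j z)) ?_ ?_
  · refine hsplit.congr (.of_forall fun z => ?_)
    simp only [Finset.prod_coe_sort X fun j => truncPow (β j) (g j z) * Real.exp (-δ * g j z),
      Finset.prod_compl_mul_prod]
  · refine (Finset.measurable_prod _ fun j _ => ?_).aestronglyMeasurable
    have hg : Measurable (g j) := (g j).continuous_of_finiteDimensional.measurable
    have := measurable_truncPow (β j)
    fun_prop
  · refine .of_forall fun z => ?_
    rw [Real.norm_of_nonneg (Finset.prod_nonneg fun j _ => hfac j _)]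
    exact Finset.prod_le_prod (fun j _ => hfac j _) fun j hj => hC j (Finset.mem_compl.1 hj) _

theorem integrable_exp_mul_weight {g : ι → V →ᵃ[ℝ] ℝ} {φ : V →ₗ[ℝ] ℝ}
    (hφ : Dominates φ g) {X : Finset ι} (hX : IsSimpleVertex g X)
    {β : ι → ℝ} (hβX : ∀ j ∈ X, -1 < β j) (hβ : ∀ j ∉ X, 0 ≤ β j) {ε : ℝ} (hε : 0 < ε) :
    Integrable (fun z => Real.exp (-(ε * φ z)) * weight g β z) μ := by
  obtain ⟨c, K, hc, hgrow⟩ := hφ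
  have hprod := integrable_prod_truncPow_mul_exp μ hX hβX hβ (mul_pos hε hc)
  refine (hprod.const_mul (Real.exp (ε * K))).mono' ?_ (.of_forall fun z => ?_)
  · have : Continuous φ := φ.continuous_of_finiteDimensional
    have := measurable_weight g β
    fun_prop
  rw [Real.norm_of_nonneg (mul_nonneg (Real.exp_pos _).le (weight_nonneg g β z)),
    Finset.prod_mul_distrib, ← Real.exp_sum, ← Finset.mul_sum]
  change _ ≤ _ * (weight g β z * _)
  by_cases hz : z ∈ polyhedron g
  · have hexp : -(ε * φ z) ≤ ε * K + -(ε * c) * ∑ j, g j z := by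
      linarith [mul_le_mul_of_nonneg_left (hgrow z hz) hε.le]
    calc Real.exp (-(ε * φ z)) * weight g β z
        ≤ Real.exp (ε * K + -(ε * c) * ∑ j, g j z) * weight g β z :=
          mul_le_mul_of_nonneg_right (Real.exp_le_exp.2 hexp) (weight_nonneg g β z)
      _ = _ := by rw [Real.exp_add]; ring
  · simp [weight_of_notMem_polyhedron β hz]

theorem integrable_expWeight {g : ι → V →ᵃ[ℝ] ℝ} {φ : V →ₗ[ℝ] ℝ} (hφ : Dominates φ g)
    {X : Finset ι} (hX : IsSimpleVertex g X) {β : ι → ℝ} (hβX : ∀ j ∈ X, -1 < β j)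
    (hβ : ∀ j ∉ X, 0 ≤ β j) {lam : ℂ} (hlam : 0 < lam.re) :
    Integrable (expWeight g φ β lam) μ := by
  refine (integrable_exp_mul_weight μ hφ hX hβX hβ hlam).mono' ?_
    (.of_forall fun z => (norm_expWeight g φ β lam z).le)
  have : Continuous φ := φ.continuous_of_finiteDimensional
  have := measurable_weight g β
  unfold expWeight
  fun_prop

end Integrability

section Laplace

theorem mem_interior_integrableExpSet_neg {Ω : Type*} [MeasurableSpace Ω] {μ : Measure Ω}
    {φ w : Ω → ℝ} (hw : Measurable w) (hw0 : ∀ z, 0 ≤ w z)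
    (hint : ∀ ε : ℝ, 0 < ε → Integrable (fun z => Real.exp (-(ε * φ z)) * w z) μ)
    {ε : ℝ} (hε : 0 < ε) :
    ε ∈ interior (ProbabilityTheory.integrableExpSet (-φ)
      (μ.withDensity fun z => ENNReal.ofReal (w z))) := by
  refine mem_interior.2 ⟨Set.Ioi 0, fun t ht => ?_, isOpen_Ioi, hε⟩
  change Integrable (fun z => Real.exp (t * -φ z)) _
  rw [integrable_withDensity_iff_integrable_smul' (by fun_prop) (.of_forall fun _ => by simp)]
  refine (hint t ht).congr (.of_forall fun z => ?_)
  simp [ENNReal.toReal_ofReal (hw0 z), mul_comm]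

theorem hasDerivAt_integral_cexp_neg_mul {Ω : Type*} [MeasurableSpace Ω] {μ : Measure Ω}
    {φ w : Ω → ℝ} (hw : Measurable w) (hw0 : ∀ z, 0 ≤ w z)
    (hint : ∀ ε : ℝ, 0 < ε → Integrable (fun z => Real.exp (-(ε * φ z)) * w z) μ)
    {lam : ℂ} (hlam : 0 < lam.re) :
    HasDerivAt (fun l : ℂ => ∫ z, Complex.exp (-l * φ z) * w z ∂μ)
      (-∫ z, φ z * (Complex.exp (-lam * φ z) * w z) ∂μ) lam := by
  have hderiv := ProbabilityTheory.hasDerivAt_complexMGF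
    (mem_interior_integrableExpSet_neg hw hw0 hint hlam)
  have hdensity : ∀ F : Ω → ℂ, ∫ z, F z ∂μ.withDensity (fun z => ENNReal.ofReal (w z)) =
      ∫ z, w z * F z ∂μ := fun F => by
    rw [integral_withDensity_eq_integral_toReal_smul (by fun_prop) (.of_forall fun _ => by simp)]
    simp [ENNReal.toReal_ofReal (hw0 _)]
  unfold ProbabilityTheory.complexMGF at hderiv
  simp_rw [hdensity] at hderiv
  rw [← integral_neg]
  convert hderiv using 4 <;> simp <;> ring_nf

end Laplace

section IntegrationByParts

variable {V ι : Type*} [NormedAddCommGroup V] [NormedSpace ℝ V] [Fintype ι]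

theorem hasDerivAt_weight_line [DecidableEq ι] {g : ι → V →ᵃ[ℝ] ℝ} {β : ι → ℝ} {z e : V} {t : ℝ}
    (hne : ∀ r, (g r).linear e ≠ 0 → g r (z + t • e) ≠ 0) :
    HasDerivAt (fun t : ℝ => weight g β (z + t • e))
      (∑ r, β r * (g r).linear e * weight g (Function.update β r (β r - 1)) (z + t • e)) t := by
  have hfactor : ∀ r ∈ Finset.univ, HasDerivAt (fun t : ℝ => truncPow (β r) (g r (z + t • e)))
      (β r * truncPow (β r - 1) (g r (z + t • e)) * (g r).linear e) t := fun r _ => by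
    have hline : HasDerivAt (fun t : ℝ => g r (z + t • e)) ((g r).linear e) t := by
      simp_rw [affine_add_smul]
      simpa using ((hasDerivAt_id t).mul_const ((g r).linear e)).const_add (g r z)
    by_cases hr : (g r).linear e = 0
    · simp_rw [affine_add_smul, hr, mul_zero]
      exact hasDerivAt_const _ _
    · exact (hasDerivAt_truncPow (β r) (hne r hr)).comp t hline
  refine (HasDerivAt.fun_finsetProd hfactor).congr_deriv (Finset.sum_congr rfl fun r _ => ?_)
  rw [weight_update, smul_eq_mul]
  ring

theorem hasDerivAt_expWeight_line [DecidableEq ι] {g : ι → V →ᵃ[ℝ] ℝ} {φ : V →ₗ[ℝ] ℝ} {β : ι → ℝ}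
    {lam : ℂ} {z e : V} {t : ℝ} (hne : ∀ r, (g r).linear e ≠ 0 → g r (z + t • e) ≠ 0) :
    HasDerivAt (fun t : ℝ => expWeight g φ β lam (z + t • e))
      (∑ r, (β r * (g r).linear e : ℝ) *
          expWeight g φ (Function.update β r (β r - 1)) lam (z + t • e) -
        lam * φ e * expWeight g φ β lam (z + t • e)) t := by
  have hφ : HasDerivAt (fun t : ℝ => φ (z + t • e)) (φ e) t := by
    simp_rw [map_add, map_smul, smul_eq_mul]
    simpa using ((hasDerivAt_id t).mul_const (φ e)).const_add (φ z)
  refine ((hφ.ofReal_comp.const_mul (-lam)).cexp.mul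
    (hasDerivAt_weight_line (β := β) hne).ofReal_comp).congr_deriv ?_
  simp only [expWeight, Complex.ofReal_sum, Complex.ofReal_mul, Finset.mul_sum]
  rw [add_comm, sub_eq_add_neg]
  congr 1
  · exact Finset.sum_congr rfl fun r _ => by ring
  · ring

theorem continuous_expWeight_line [FiniteDimensional ℝ V] {g : ι → V →ᵃ[ℝ] ℝ} {φ : V →ₗ[ℝ] ℝ}
    {β : ι → ℝ} {e : V} (hβ : ∀ r, (g r).linear e ≠ 0 → 0 < β r) (lam : ℂ) (z : V) :
    Continuous fun t : ℝ => expWeight g φ β lam (z + t • e) := by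
  have hweight : Continuous fun t : ℝ => weight g β (z + t • e) := by
    refine continuous_finsetProd _ fun r _ => ?_
    simp_rw [affine_add_smul]
    by_cases hr : (g r).linear e = 0
    · simp_rw [hr, mul_zero]
      exact continuous_const
    · exact (continuous_truncPow (hβ r hr)).comp (by fun_prop)
  have hφ : Continuous φ := φ.continuous_of_finiteDimensional
  unfold expWeight
  fun_prop

variable [FiniteDimensional ℝ V] [MeasurableSpace V] [BorelSpace V]
  (μ : Measure V) [μ.IsAddHaarMeasure]

/- Averaging the fundamental theorem of calculus over the segments `[z, z + e]`: the mean of `G'`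
along the segment integrates to `∫ G'` and also to `∫ (G (z + e) - G z) = 0`. -/
theorem integral_eq_zero_of_hasDerivAt_line {E : Type*} [NormedAddCommGroup E] [NormedSpace ℝ E]
    [CompleteSpace E] {G G' : V → E} (hG : Integrable G μ) (hG' : Integrable G' μ) (e : V)
    (hc : ∀ z, Continuous fun t : ℝ => G (z + t • e))
    (hd : ∀ z, ∃ s : Set ℝ, s.Countable ∧
      ∀ t ∉ s, HasDerivAt (fun t : ℝ => G (z + t • e)) (G' (z + t • e)) t) :
    ∫ z, G' z ∂μ = 0 := by
  set ν : Measure ℝ := volume.restrict (Set.Ioc 0 1)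
  have hν : IsProbabilityMeasure ν := ⟨by simp [ν]⟩
  have hshear : MeasurePreserving (fun p : ℝ × V => (p.1, p.2 + p.1 • e)) (ν.prod μ) (ν.prod μ) :=
    (MeasurePreserving.id ν).skew_product (g := fun t z => z + t • e)
      (by fun_prop) (.of_forall fun t => map_add_right_eq_self μ (t • e))
  have hint : Integrable (fun p : ℝ × V => G' (p.2 + p.1 • e)) (ν.prod μ) :=
    hshear.integrable_comp_of_integrable (g := fun p : ℝ × V => G' p.2) (hG'.comp_snd ν)
  have hftc : ∀ᵐ z ∂μ, ∫ t, G' (z + t • e) ∂ν = G (z + e) - G z := by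
    filter_upwards [hint.prod_left_ae] with z hz
    obtain ⟨s, hs, hds⟩ := hd z
    have h := integral_eq_of_hasDerivAt_off_countable_of_le (fun t : ℝ => G (z + t • e))
      (fun t => G' (z + t • e)) zero_le_one hs (hc z).continuousOn (fun t ht => hds t ht.2)
      ((intervalIntegrable_iff_integrableOn_Ioc_of_le zero_le_one).2 hz)
    rw [intervalIntegral.integral_of_le zero_le_one] at h
    simpa using h
  calc ∫ z, G' z ∂μ = ∫ _t, ∫ z, G' z ∂μ ∂ν := by simp
    _ = ∫ t, ∫ z, G' (z + t • e) ∂μ ∂ν := by simp_rw [integral_add_right_eq_self (μ := μ) G']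
    _ = ∫ z, ∫ t, G' (z + t • e) ∂ν ∂μ := integral_integral_swap hint
    _ = ∫ z, (G (z + e) - G z) ∂μ := integral_congr_ae hftc
    _ = 0 := by
      rw [integral_sub (hG.comp_add_right e) hG, integral_add_right_eq_self G e, sub_self]

theorem mul_integral_expWeight_eq_sum [DecidableEq ι] {g : ι → V →ᵃ[ℝ] ℝ} {φ : V →ₗ[ℝ] ℝ}
    {β : ι → ℝ} {e : V} {lam : ℂ} (hβ : ∀ r, (g r).linear e ≠ 0 → 0 < β r)
    (hint : Integrable (expWeight g φ β lam) μ)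
    (hint' : ∀ r, (g r).linear e ≠ 0 →
      Integrable (expWeight g φ (Function.update β r (β r - 1)) lam) μ) :
    lam * φ e * ∫ z, expWeight g φ β lam z ∂μ =
      ∑ r, (β r * (g r).linear e : ℝ) *
        ∫ z, expWeight g φ (Function.update β r (β r - 1)) lam z ∂μ := by
  have hterm : ∀ r ∈ Finset.univ, Integrable (fun z => ((β r * (g r).linear e : ℝ) : ℂ) *
      expWeight g φ (Function.update β r (β r - 1)) lam z) μ := fun r _ => by
    by_cases hr : (g r).linear e = 0
    · simp [hr]
    · exact (hint' r hr).const_mul _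
  have hsum := integrable_finsetSum _ hterm
  have hzero := integral_eq_zero_of_hasDerivAt_line μ hint (hsum.sub (hint.const_mul (lam * φ e))) e
    (continuous_expWeight_line hβ lam) fun z =>
      ⟨Set.range fun r => -g r z / (g r).linear e, Set.countable_range _, fun t ht =>
        hasDerivAt_expWeight_line fun r hr h0 => ht ⟨r, ?_⟩⟩
  · rw [integral_sub' hsum (hint.const_mul _), integral_finsetSum _ hterm, sub_eq_zero] at hzero
    simpa only [integral_const_mul] using hzero.symm
  · rw [affine_add_smul] at h0
    field_simp
    linarith

end IntegrationByParts

section SimpleVertex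

variable {V ι : Type*} [NormedAddCommGroup V] [NormedSpace ℝ V]

namespace IsSimpleVertex

variable {g : ι → V →ᵃ[ℝ] ℝ} {X : Finset ι}

theorem smul (hX : IsSimpleVertex g X) {s : ι → ℝ} (hs : ∀ j, s j ≠ 0) :
    IsSimpleVertex (fun j => s j • g j) X where
  card_eq := hX.card_eq
  eq_zero v hv := hX.eq_zero v fun j hj => (mul_eq_zero.1 (hv j hj)).resolve_left (hs j)

variable [DecidableEq ι]

theorem linear_ne_zero (hX : IsSimpleVertex g X) {j : ι} {e : V}
    (he : ∀ i ∈ X.erase j, (g i).linear e = 0) (he0 : e ≠ 0) : (g j).linear e ≠ 0 := fun h =>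
  he0 <| hX.eq_zero e fun i hi => by
    obtain rfl | hij := eq_or_ne i j
    · exact h
    · exact he i (Finset.mem_erase.2 ⟨hij, hi⟩)

theorem exists_eq_smul (hX : IsSimpleVertex g X) {j : ι} {e : V}
    (he : ∀ i ∈ X.erase j, (g i).linear e = 0) (he0 : e ≠ 0) {v : V}
    (hv : ∀ i ∈ X.erase j, (g i).linear v = 0) : ∃ t : ℝ, v = t • e := by
  refine ⟨(g j).linear v / (g j).linear e, sub_eq_zero.1 (hX.eq_zero _ fun i hi => ?_)⟩
  rw [map_sub, map_smul, smul_eq_mul]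
  obtain rfl | hij := eq_or_ne i j
  · rw [div_mul_cancel₀ _ (hX.linear_ne_zero he he0), sub_self]
  · have hi' := Finset.mem_erase.2 ⟨hij, hi⟩
    rw [he i hi', hv i hi', mul_zero, sub_zero]

theorem insert_erase (hX : IsSimpleVertex g X) {j r : ι} (hj : j ∈ X) {e : V}
    (he : ∀ i ∈ X.erase j, (g i).linear e = 0) (hr : (g r).linear e ≠ 0) :
    IsSimpleVertex g (insert r (X.erase j)) where
  card_eq := by
    rw [Finset.card_insert_of_notMem fun h => hr (he r h), Finset.card_erase_add_one hj, hX.card_eq]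
  eq_zero v hv := by
    have he0 : e ≠ 0 := fun h => hr (by rw [h, map_zero])
    obtain ⟨t, rfl⟩ := hX.exists_eq_smul he he0 fun i hi => hv i (Finset.mem_insert_of_mem hi)
    have ht := hv r (Finset.mem_insert_self r _)
    rw [map_smul, smul_eq_mul] at ht
    rw [(mul_eq_zero.1 ht).resolve_right hr, zero_smul]

theorem form_eq_add_sum (hX : IsSimpleVertex g X) {φ : V →ₗ[ℝ] ℝ} {p : V}
    (hp : ∀ j ∈ X, g j p = 0) {e : ι → V}
    (he : ∀ j ∈ X, ∀ i ∈ X.erase j, (g i).linear (e j) = 0) (hφe : ∀ j ∈ X, φ (e j) = 1) (z : V) :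
    φ z = φ p + ∑ j ∈ X, ((g j).linear (e j))⁻¹ * g j z := by
  have hlin : ∀ j ∈ X, (g j).linear (z - p) = g j z := fun j hj => by
    simpa [hp j hj] using (g j).linearMap_vsub z p
  have hne : ∀ j ∈ X, (g j).linear (e j) ≠ 0 := fun j hj =>
    hX.linear_ne_zero (he j hj) fun h => by simpa [h] using hφe j hj
  have hexpand : z - p = ∑ j ∈ X, (((g j).linear (e j))⁻¹ * g j z) • e j := by
    refine sub_eq_zero.1 (hX.eq_zero _ fun i hi => ?_)
    rw [map_sub, hlin i hi, map_sum, Finset.sum_eq_single_of_mem i hi fun j hj hji => by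
      rw [map_smul, he j hj i (Finset.mem_erase.2 ⟨hji.symm, hi⟩), smul_zero],
      map_smul, smul_eq_mul]
    field_simp [hne i hi]
    ring
  rw [← sub_eq_iff_eq_add', ← map_sub, hexpand, map_sum]
  exact Finset.sum_congr rfl fun j hj => by rw [map_smul, hφe j hj, smul_eq_mul, mul_one]

end IsSimpleVertex

end SimpleVertex

section Lowered

variable {ι : Type*} [DecidableEq ι]

/-- The exponents `α` lowered by one on `S`: those of the densities `∏ g_j ^ α_j / ∏_S g_j`. -/
def lowered (α : ι → ℝ) (S : Finset ι) (j : ι) : ℝ :=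
  if j ∈ S then α j - 1 else α j

theorem lowered_of_mem (α : ι → ℝ) {S : Finset ι} {j : ι} (hj : j ∈ S) :
    lowered α S j = α j - 1 := if_pos hj

theorem lowered_of_notMem (α : ι → ℝ) {S : Finset ι} {j : ι} (hj : j ∉ S) :
    lowered α S j = α j := if_neg hj

theorem update_lowered (α : ι → ℝ) {S : Finset ι} {r : ι} (hr : r ∉ S) :
    Function.update (lowered α S) r (lowered α S r - 1) = lowered α (insert r S) := by
  ext j
  obtain rfl | hj := eq_or_ne j r
  · rw [Function.update_self, lowered_of_notMem α hr, lowered_of_mem α (Finset.mem_insert_self j S)]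
  · simp only [Function.update_of_ne hj, lowered, Finset.mem_insert, or_iff_right hj]

end Lowered

section DifferentialSystem

variable {V ι : Type*} [NormedAddCommGroup V] [NormedSpace ℝ V] [Fintype ι] [DecidableEq ι]
  {g : ι → V →ᵃ[ℝ] ℝ} {φ : V →ₗ[ℝ] ℝ} {α : ι → ℝ} {X : Finset ι} {lam : ℂ}

theorem mul_expWeight_lowered {j : ι} (hj : j ∈ X) (z : V) :
    g j z * expWeight g φ (lowered α X) lam z = expWeight g φ (lowered α (X.erase j)) lam z := by
  have h := mul_weight_update_sub_one g (lowered α (X.erase j)) j z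
  rw [update_lowered α (Finset.notMem_erase j X), Finset.insert_erase hj] at h
  rw [expWeight, expWeight, ← h, Complex.ofReal_mul]
  ring

variable [FiniteDimensional ℝ V] [MeasurableSpace V] [BorelSpace V]
  (μ : Measure V) [μ.IsAddHaarMeasure]

theorem integrable_expWeight_lowered (hφ : Dominates φ g) (hX : IsSimpleVertex g X)
    (hα : ∀ j, 0 < α j) {S : Finset ι} (hS : S ⊆ X) (hlam : 0 < lam.re) :
    Integrable (expWeight g φ (lowered α S) lam) μ := by
  refine integrable_expWeight μ hφ hX (fun j _ => ?_) (fun j hj => ?_) hlam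
  · unfold lowered
    split_ifs <;> linarith [hα j]
  · rw [lowered_of_notMem α fun h => hj (hS h)]
    exact (hα j).le

theorem mul_integral_expWeight_lowered_erase (hφ : Dominates φ g) (hX : IsSimpleVertex g X)
    (hα : ∀ j, 0 < α j) (hlam : 0 < lam.re) {j : ι} (hj : j ∈ X) {e : V}
    (he : ∀ i ∈ X.erase j, (g i).linear e = 0) :
    lam * φ e * ∫ z, expWeight g φ (lowered α (X.erase j)) lam z ∂μ =
      ∑ r ∈ (X.erase j)ᶜ, (α r * (g r).linear e : ℝ) *
        ∫ z, expWeight g φ (lowered α (insert r (X.erase j))) lam z ∂μ := by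
  have hnotMem : ∀ r, (g r).linear e ≠ 0 → r ∉ X.erase j := fun r hr h => hr (he r h)
  rw [mul_integral_expWeight_eq_sum μ (fun r hr => ?_)
    (integrable_expWeight_lowered μ hφ hX hα (X.erase_subset j) hlam) fun r hr => ?_]
  · refine (Finset.sum_subset (Finset.subset_univ _) fun r _ hr => ?_).symm.trans
      (Finset.sum_congr rfl fun r hr => ?_)
    · rw [he r (by simpa using hr), mul_zero, Complex.ofReal_zero, zero_mul]
    · have hr := Finset.mem_compl.1 hr
      rw [update_lowered α hr, lowered_of_notMem α hr]
  · rw [lowered_of_notMem α (hnotMem r hr)]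
    exact hα r
  · rw [update_lowered α (hnotMem r hr)]
    exact integrable_expWeight_lowered μ hφ (hX.insert_erase hj he hr) hα subset_rfl hlam

theorem integral_form_mul_expWeight_lowered (hφ : Dominates φ g) (hX : IsSimpleVertex g X)
    (hα : ∀ j, 0 < α j) (hlam : 0 < lam.re) {p : V} (hp : ∀ j ∈ X, g j p = 0) {e : ι → V}
    (he : ∀ j ∈ X, ∀ i ∈ X.erase j, (g i).linear (e j) = 0) (hφe : ∀ j ∈ X, φ (e j) = 1) :
    ∫ z, φ z * expWeight g φ (lowered α X) lam z ∂μ =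
      φ p * (∫ z, expWeight g φ (lowered α X) lam z ∂μ) +
        ∑ j ∈ X, ((g j).linear (e j) : ℂ)⁻¹ *
          ∫ z, expWeight g φ (lowered α (X.erase j)) lam z ∂μ := by
  have hpoint : ∀ z, φ z * expWeight g φ (lowered α X) lam z =
      φ p * expWeight g φ (lowered α X) lam z + ∑ j ∈ X, ((g j).linear (e j) : ℂ)⁻¹ *
        expWeight g φ (lowered α (X.erase j)) lam z := fun z => by
    rw [hX.form_eq_add_sum hp he hφe z]
    push_cast
    rw [add_mul, Finset.sum_mul]
    congr 1
    exact Finset.sum_congr rfl fun j hj => by rw [mul_assoc, mul_expWeight_lowered hj]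
  have hint : ∀ S ⊆ X, Integrable (expWeight g φ (lowered α S) lam) μ := fun S hS =>
    integrable_expWeight_lowered μ hφ hX hα hS hlam
  simp_rw [hpoint]
  rw [integral_add ((hint X subset_rfl).const_mul _) (integrable_finsetSum _ fun j _ =>
      (hint _ (X.erase_subset j)).const_mul _), integral_finsetSum _ fun j _ =>
      (hint _ (X.erase_subset j)).const_mul _]
  simp_rw [integral_const_mul]

theorem hasDerivAt_integral_expWeight_lowered (hφ : Dominates φ g) (hX : IsSimpleVertex g X)
    (hα : ∀ j, 0 < α j) (hlam : 0 < lam.re) {p : V} (hp : ∀ j ∈ X, g j p = 0) {e : ι → V}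
    (he : ∀ j ∈ X, ∀ i ∈ X.erase j, (g i).linear (e j) = 0) (hφe : ∀ j ∈ X, φ (e j) = 1) :
    HasDerivAt (fun l => ∫ z, expWeight g φ (lowered α X) l z ∂μ)
      (-(φ p * (∫ z, expWeight g φ (lowered α X) lam z ∂μ) + lam⁻¹ * ∑ j ∈ X,
        ∑ r ∈ (X.erase j)ᶜ, (α r * ((g r).linear (e j) / (g j).linear (e j)) : ℝ) *
          ∫ z, expWeight g φ (lowered α (insert r (X.erase j))) lam z ∂μ)) lam := by
  refine (hasDerivAt_integral_cexp_neg_mul (measurable_weight g _) (weight_nonneg g _)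
    (fun ε hε => integrable_exp_mul_weight μ hφ hX (fun j hj => ?_) (fun j hj => ?_) hε)
    hlam).congr_deriv (congrArg Neg.neg ?_)
  · rw [lowered_of_mem α hj]
    linarith [hα j]
  · rw [lowered_of_notMem α hj]
    exact (hα j).le
  refine (integral_form_mul_expWeight_lowered μ hφ hX hα hlam hp he hφe).trans ?_
  have hlam0 : lam ≠ 0 := fun h => by simp [h] at hlam
  congr 1
  rw [Finset.mul_sum]
  refine Finset.sum_congr rfl fun j hj => ?_
  have hparts := mul_integral_expWeight_lowered_erase μ hφ hX hα hlam hj (he j hj)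
  rw [hφe j hj, Complex.ofReal_one, mul_one] at hparts
  rw [← inv_mul_cancel_left₀ hlam0 (∫ z, expWeight g φ (lowered α (X.erase j)) lam z ∂μ), hparts,
    mul_left_comm, Finset.mul_sum]
  congr 1
  refine Finset.sum_congr rfl fun r _ => ?_
  push_cast
  ring

end DifferentialSystem

section ConnectedComponents

variable {V ι : Type*} [NormedAddCommGroup V] [NormedSpace ℝ V]

theorem convex_polyhedron (g : ι → V →ᵃ[ℝ] ℝ) : Convex ℝ (polyhedron g) := by
  simp only [polyhedron, Set.ofPred_forall]
  exact convex_iInter fun j => (convex_Ioi 0).affine_preimage (g j)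

variable [FiniteDimensional ℝ V]

theorem isOpen_polyhedron [Finite ι] (g : ι → V →ᵃ[ℝ] ℝ) : IsOpen (polyhedron g) := by
  simp only [polyhedron, Set.ofPred_forall]
  exact isOpen_iInter_of_finite fun j =>
    isOpen_lt continuous_const (g j).continuous_of_finiteDimensional

theorem connectedComponentIn_eq_polyhedron (f : ι → V →ᵃ[ℝ] ℝ) {s : ι → ℝ} {x : V}
    (hx : x ∈ polyhedron fun j => s j • f j) :
    connectedComponentIn {z | ∀ j, f j z ≠ 0} x = polyhedron fun j => s j • f j := by
  have hne : ∀ {z}, z ∈ polyhedron (fun j => s j • f j) → ∀ j, f j z ≠ 0 := fun {z} hz j =>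
    right_ne_zero_of_mul (hz j).ne'
  have hs : ∀ j, s j ≠ 0 := fun j => left_ne_zero_of_mul (hx j).ne'
  refine Set.Subset.antisymm (fun y hy j => ?_)
    ((convex_polyhedron _).isPreconnected.subset_connectedComponentIn hx fun z hz => hne hz)
  by_contra hneg
  obtain ⟨z, hz, hz0⟩ := isPreconnected_connectedComponentIn.intermediate_value hy
    (mem_connectedComponentIn (hne hx))
    (s j • f j).continuous_of_finiteDimensional.continuousOn ⟨not_lt.1 hneg, (hx j).le⟩
  exact connectedComponentIn_subset _ _ hz j ((mul_eq_zero.1 hz0).resolve_left (hs j))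

end ConnectedComponents

section Arrangement

variable {N k : ℕ} {f : Fin N → Space k →ᵃ[ℝ] ℝ} {f₀ : Space k →ₗ[ℝ] ℝ}

theorem exists_eq_polyhedron_of_mem_domains {Δ : Set (Space k)} (hΔ : Δ ∈ domains f) :
    ∃ s : Fin N → ℝ, (∀ j, |s j| = 1) ∧ Δ = polyhedron (fun j => s j • f j) ∧ Δ.Nonempty := by
  obtain ⟨x, hx, rfl⟩ := hΔ
  have hcompl : arrangementCompl f = {z | ∀ j, f j z ≠ 0} := by
    ext z
    simp [arrangementCompl, hyperplane]
  have hx' : x ∈ {z | ∀ j, f j z ≠ 0} := hcompl ▸ hx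
  refine ⟨fun j => f j x / |f j x|, fun j => ?_, ?_, ⟨x, mem_connectedComponentIn hx⟩⟩
  · rw [abs_div, abs_abs, div_self (abs_ne_zero.2 (hx' j))]
  · rw [hcompl]
    refine connectedComponentIn_eq_polyhedron f fun j => ?_
    change 0 < f j x / |f j x| * f j x
    rw [div_mul_eq_mul_div]
    exact div_pos (mul_self_pos.2 (hx' j)) (abs_pos.2 (hx' j))

theorem linear_sub_eq_zero_of_mem_flat {U : Finset (Fin N)} {z w : Space k} (hz : z ∈ flat f U)
    (hw : w ∈ flat f U) {j : Fin N} (hj : j ∈ U) : (f j).linear (z - w) = 0 := by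
  have hz : f j z = 0 := hz j hj
  have hw : f j w = 0 := hw j hj
  simpa [hz, hw] using (f j).linearMap_vsub z w

theorem add_mem_flat {U : Finset (Fin N)} {z v : Space k} (hz : z ∈ flat f U)
    (hv : ∀ j ∈ U, (f j).linear v = 0) : z + v ∈ flat f U := fun j hj => by
  have hz : f j z = 0 := hz j hj
  have h := affine_add_smul (f j) z v 1
  rwa [one_smul, hz, hv j hj, mul_zero, add_zero] at h

theorem isSimpleVertex_of_flat_eq_singleton (X : Vertex N k) (hX : ∃ z, flat f X.1 = {z}) :
    IsSimpleVertex f X.1 where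
  card_eq := by rw [X.2, finrank_euclideanSpace_fin]
  eq_zero v hv := by
    obtain ⟨z, hz⟩ := hX
    have h := add_mem_flat (hz ▸ Set.mem_singleton z) hv
    rw [hz] at h
    exact add_eq_left.1 h

theorem apply_vertexPoint {X : Vertex N k} (hX : ∃ z, flat f X.1 = {z}) {j : Fin N}
    (hj : j ∈ X.1) : f j (vertexPoint f X) = 0 := by
  have h : flat f X.1 = {vertexPoint f X} := Classical.epsilon_spec hX
  exact (h ▸ Set.mem_singleton _ : vertexPoint f X ∈ flat f X.1) j hj

theorem edgeVector_spec {X : Finset (Fin N)} (hX : IsSimpleVertex f X) {j : Fin N}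
    (hf₀ : ∃ z ∈ flat f (X.erase j), ∃ w ∈ flat f (X.erase j), f₀ z ≠ f₀ w) :
    (∀ i ∈ X.erase j, (f i).linear (edgeVector f f₀ (X.erase j)) = 0) ∧
      f₀ (edgeVector f f₀ (X.erase j)) = 1 := by
  set U := X.erase j
  obtain ⟨z, hz, w, hw, hzw⟩ := hf₀
  have hne : f₀ (z - w) ≠ 0 := by rwa [map_sub, sub_ne_zero]
  have hexists : ∃ e, (∃ p, flat f U = Set.range fun t : ℝ => p + t • e) ∧ f₀ e = 1 := by
    set e := (f₀ (z - w))⁻¹ • (z - w)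
    have he : ∀ i ∈ U, (f i).linear e = 0 := fun i hi => by
      rw [map_smul, linear_sub_eq_zero_of_mem_flat hz hw hi, smul_zero]
    have he1 : f₀ e = 1 := by rw [map_smul, smul_eq_mul, inv_mul_cancel₀ hne]
    refine ⟨e, ⟨w, Set.Subset.antisymm (fun x hx => ?_) ?_⟩, he1⟩
    · obtain ⟨t, ht⟩ := hX.exists_eq_smul he (fun h => by simp [h] at he1)
        fun i hi => linear_sub_eq_zero_of_mem_flat hx hw hi
      exact ⟨t, by simp only [← ht, add_sub_cancel]⟩
    · rintro _ ⟨t, rfl⟩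
      exact add_mem_flat hw fun i hi => by rw [map_smul, he i hi, smul_zero]
  obtain ⟨⟨p, hp⟩, he1⟩ := Classical.epsilon_spec hexists
  refine ⟨fun i hi => ?_, he1⟩
  have hmem : ∀ t : ℝ, p + t • edgeVector f f₀ U ∈ flat f U := fun t => hp ▸ ⟨t, rfl⟩
  simpa using linear_sub_eq_zero_of_mem_flat (hmem 1) (hmem 0) hi

theorem exists_form_ne_zero (hN : k ≤ N) (hsimple : ∀ X : Vertex N k, IsSimpleVertex f X.1)
    (hf₀ : ∀ U : Finset (Fin N), U.card + 1 = k → ∃ z ∈ flat f U, ∃ w ∈ flat f U, f₀ z ≠ f₀ w)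
    {v : Space k} (hv : v ≠ 0) :
    ∃ w, (∀ j, (f j).linear v = 0 → (f j).linear w = 0) ∧ f₀ w ≠ 0 := by
  classical
  set S : Finset (Fin N) := {j | (f j).linear v = 0}
  have hS : S.card < k := by
    by_contra! hle
    obtain ⟨X, hXS, hX⟩ := Finset.exists_subset_card_eq hle
    exact hv ((hsimple ⟨X, hX⟩).eq_zero v fun j hj => (Finset.mem_filter.1 (hXS hj)).2)
  obtain ⟨U, hSU, -, hU⟩ := Finset.exists_subsuperset_card_eq (Finset.subset_univ S)
    (Nat.le_sub_one_of_lt hS) (by rw [Finset.card_fin]; omega)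
  obtain ⟨z, hz, w, hw, hzw⟩ := hf₀ U (by omega)
  refine ⟨z - w, fun j hj => linear_sub_eq_zero_of_mem_flat hz hw (hSU ?_), ?_⟩
  · exact Finset.mem_filter.2 ⟨Finset.mem_univ j, hj⟩
  · rwa [map_sub, sub_ne_zero]

end Arrangement

section Wedge

theorem det_updateCol_mul {n R : Type*} [Fintype n] [DecidableEq n] [CommRing R]
    {A : Matrix n n R} {x : n → R} {i : n} {c : R} (hx : Matrix.vecMul x A = Pi.single i c)
    (b : n → R) : (A.updateCol i b).det * c = A.det * (x ⬝ᵥ b) := by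
  have hadj : c • A.adjugate.row i = A.det • x := by
    have h := congrArg (fun y => Matrix.vecMul y A.adjugate) hx
    simpa [Matrix.vecMul_vecMul, Matrix.mul_adjugate, Matrix.vecMul_smul] using h.symm
  calc (A.updateCol i b).det * c = (A.adjugate.row i ⬝ᵥ b) * c := by
        rw [← Matrix.cramer_apply, Matrix.cramer_eq_adjugate_mulVec]
        rfl
    _ = (c • A.adjugate.row i) ⬝ᵥ b := by rw [smul_dotProduct, smul_eq_mul, mul_comm]
    _ = A.det * (x ⬝ᵥ b) := by rw [hadj, smul_dotProduct, smul_eq_mul]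

variable {N k : ℕ}

theorem wedge_update_mul {φ : Fin k → Space k →ₗ[ℝ] ℝ} {i : Fin k} {e : Space k}
    (he : ∀ i' ≠ i, φ i' e = 0) (ψ : Space k →ₗ[ℝ] ℝ) :
    wedge (Function.update φ i ψ) (EuclideanSpace.basisFun (Fin k) ℝ) * φ i e =
      wedge φ (EuclideanSpace.basisFun (Fin k) ℝ) * ψ e := by
  set b := EuclideanSpace.basisFun (Fin k) ℝ
  have hcoord : ∀ χ : Space k →ₗ[ℝ] ℝ, (⇑e ⬝ᵥ fun m => χ (b m)) = χ e := fun χ => by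
    conv_rhs => rw [← b.sum_repr e, map_sum]
    simp [dotProduct, b]
  have hwedge : ∀ χ : Fin k → Space k →ₗ[ℝ] ℝ, wedge χ b = (Matrix.of fun m j => χ j (b m)).det :=
    fun _ => rfl
  have hcol : (Matrix.of fun m j => Function.update φ i ψ j (b m)) =
      (Matrix.of fun m j => φ j (b m)).updateCol i fun m => ψ (b m) := by
    ext m j
    obtain rfl | hj := eq_or_ne j i
    · simp
    · simp [hj]
  have he' : Matrix.vecMul e (Matrix.of fun m j => φ j (b m)) = Pi.single i (φ i e) := by
    ext j
    refine (hcoord (φ j)).trans ?_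
    obtain rfl | hj := eq_or_ne j i
    · simp
    · rw [he j hj, Pi.single_eq_of_ne hj]
  rw [hwedge, hwedge, hcol, det_updateCol_mul he', hcoord]

theorem orientedCoeff_posOriented (o : Orientation ℝ (Space k) (Fin k))
    (η : Space k [⋀^Fin k]→ₗ[ℝ] ℝ) :
    orientedCoeff o (posOriented o η) = |η (EuclideanSpace.basisFun (Fin k) ℝ)| := by
  have habs : |orientedCoeff o η| = |η (EuclideanSpace.basisFun (Fin k) ℝ)| := by
    rw [orientedCoeff, abs_mul]
    split_ifs <;> simp
  rw [← habs, posOriented]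
  split_ifs with hpos
  · exact (abs_of_pos hpos).symm
  · rw [orientedCoeff_neg, abs_of_nonpos (not_lt.1 hpos)]

/-- The absolute value of the coefficient of `⋀_{j ∈ X} df_j`, which does not depend on the order
of the factors. -/
def volCoeff (f : Fin N → Space k →ᵃ[ℝ] ℝ) (X : Vertex N k) : ℝ :=
  |wedge (fun i => (f (X.1.orderEmbOfFin X.2 i)).linear) (EuclideanSpace.basisFun (Fin k) ℝ)|

theorem volCoeff_eq_abs_wedge (f : Fin N → Space k →ᵃ[ℝ] ℝ) (X : Vertex N k) (e : Fin k ≃ X.1) :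
    volCoeff f X =
      |wedge (fun i => (f (e i)).linear) (EuclideanSpace.basisFun (Fin k) ℝ)| := by
  set e₀ : Fin k ≃ X.1 := (X.1.orderIsoOfFin X.2).toEquiv
  have h := wedge_perm (fun i => (f (e₀ i)).linear) (e.trans e₀.symm)
  simp only [Equiv.trans_apply, Equiv.apply_symm_apply] at h
  rw [h, AlternatingMap.smul_apply, smul_eq_mul, abs_mul, abs_unit_intCast, one_mul]
  rfl

theorem orientedCoeff_vertexForm (o : Orientation ℝ (Space k) (Fin k))
    (f : Fin N → Space k →ᵃ[ℝ] ℝ) (X : Vertex N k) (z : Space k) :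
    orientedCoeff o (vertexForm o f X z) = (∏ j ∈ X.1, f j z)⁻¹ * volCoeff f X := by
  rw [volCoeff, ← orientedCoeff_posOriented o, vertexForm]
  simp only [orientedCoeff, AlternatingMap.smul_apply, smul_eq_mul]
  ring

end Wedge

section Swap

variable {N k : ℕ}

/-- The vertex obtained from `X` by exchanging the roles of the indices `j` and `r`. For `j ∈ X`
and `r ∉ X` it is the neighbour `(X \ {j}) ∪ {r}` of `X`. -/
def swapVertex (X : Vertex N k) (j r : Fin N) : Vertex N k :=
  ⟨X.1.map (Equiv.swap j r).toEmbedding, by rw [Finset.card_map, X.2]⟩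

theorem swapVertex_val {X : Vertex N k} {j r : Fin N} (hj : j ∈ X.1) (hr : r ∉ X.1.erase j) :
    (swapVertex X j r).1 = insert r (X.1.erase j) := by
  ext i
  simp only [swapVertex, Finset.mem_map_equiv, Equiv.symm_swap, Finset.mem_insert,
    Finset.mem_erase, Equiv.swap_apply_def] at hr ⊢
  grind

theorem swapVertex_self (X : Vertex N k) (j : Fin N) : swapVertex X j j = X :=
  Subtype.ext (by simp [swapVertex])

theorem swapVertex_eq_iff {X Y : Vertex N k} {j r : Fin N} (hj : j ∈ X.1) (hr : r ∉ X.1) :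
    swapVertex X j r = Y ↔ X.1 \ Y.1 = {j} ∧ Y.1 \ X.1 = {r} := by
  rw [Subtype.ext_iff, swapVertex_val hj fun h => hr (Finset.mem_of_mem_erase h)]
  simp only [Finset.ext_iff, Finset.mem_insert, Finset.mem_erase, Finset.mem_sdiff,
    Finset.mem_singleton]
  grind

theorem volCoeff_swapVertex_mul (f : Fin N → Space k →ᵃ[ℝ] ℝ) {X : Vertex N k} {j r : Fin N}
    (hj : j ∈ X.1) (hr : r ∉ X.1.erase j) {e : Space k}
    (he : ∀ i ∈ X.1.erase j, (f i).linear e = 0) :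
    volCoeff f (swapVertex X j r) * |(f j).linear e| = volCoeff f X * |(f r).linear e| := by
  set e₀ : Fin k ≃ X.1 := (X.1.orderIsoOfFin X.2).toEquiv
  obtain ⟨i₀, hi₀⟩ : ∃ i, e₀ i = ⟨j, hj⟩ := e₀.surjective _
  have hne : ∀ i ≠ i₀, (e₀ i : Fin N) ∈ X.1.erase j := fun i hi =>
    Finset.mem_erase.2 ⟨fun h => hi (e₀.injective (Subtype.ext (h.trans (by rw [hi₀])))), (e₀ i).2⟩
  have hupdate : (fun i => (f (Equiv.swap j r (e₀ i))).linear) =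
      Function.update (fun i => (f (e₀ i)).linear) i₀ (f r).linear := by
    ext1 i
    obtain rfl | hi := eq_or_ne i i₀
    · simp [hi₀]
    · rw [Function.update_of_ne hi, Equiv.swap_apply_of_ne_of_ne
        (Finset.ne_of_mem_erase (hne i hi)) fun h => hr (by rw [← h]; exact hne i hi)]
  have hmul := wedge_update_mul (φ := fun i => (f (e₀ i)).linear) (i := i₀)
    (fun i hi => he _ (hne i hi)) (f r).linear
  rw [volCoeff_eq_abs_wedge f X e₀, volCoeff_eq_abs_wedge f (swapVertex X j r)
    (e₀.trans ((Equiv.swap j r).subtypeEquiv fun i => by simp [swapVertex])), ← abs_mul, ← abs_mul]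
  simp only [hi₀] at hmul
  rw [← hmul, ← hupdate]
  rfl

end Swap

section ConnectionMatrix

variable {N k : ℕ} {f : Fin N → Space k →ᵃ[ℝ] ℝ} {f₀ : Space k →ₗ[ℝ] ℝ}

theorem card_inter_add_one_eq_iff {X Y : Vertex N k} :
    (X.1 ∩ Y.1).card + 1 = k ↔ ∃ j r, X.1 \ Y.1 = {j} ∧ Y.1 \ X.1 = {r} := by
  have hX := X.2 ▸ Finset.card_sdiff_add_card_inter X.1 Y.1
  have hY := Y.2 ▸ Finset.card_sdiff_add_card_inter Y.1 X.1
  rw [Finset.inter_comm] at hY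
  simp only [exists_and_left, exists_and_right, ← Finset.card_eq_one]
  omega

theorem matB_eq_sum_swapVertex (α : Fin N → ℝ) {X : Vertex N k}
    (hne : ∀ j ∈ X.1, (f j).linear (edgeVector f f₀ (X.1.erase j)) ≠ 0) (Y : Vertex N k) :
    matB f f₀ α X Y = ∑ j ∈ X.1, ∑ r ∈ (X.1.erase j)ᶜ,
      if swapVertex X j r = Y then relSign f f₀ j r (X.1.erase j) * α r else 0 := by
  obtain rfl | hXY := eq_or_ne X Y
  · rw [matB, Matrix.of_apply, if_pos rfl]
    refine Finset.sum_congr rfl fun j hj => ?_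
    rw [Finset.sum_eq_single_of_mem j (by simp), if_pos (swapVertex_self X j), relSign,
      Real.sign_of_pos (mul_self_pos.2 (hne j hj)), one_mul]
    refine fun r hr hrj => if_neg fun h => ?_
    have hrX : r ∉ X.1 := fun h => Finset.mem_compl.1 hr (Finset.mem_erase.2 ⟨hrj, h⟩)
    simpa [eq_comm] using ((swapVertex_eq_iff hj hrX).1 h).1
  · have hswap : ∀ j ∈ X.1, ∀ r ∈ (X.1.erase j)ᶜ,
        swapVertex X j r = Y → X.1 \ Y.1 = {j} ∧ Y.1 \ X.1 = {r} := fun j hj r hr h => by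
      refine (swapVertex_eq_iff hj fun hrX => hXY ?_).1 h
      obtain rfl : r = j := by simpa [hrX] using hr
      rw [← h, swapVertex_self]
    rw [matB, Matrix.of_apply, if_neg hXY]
    split_ifs with hcard
    · obtain ⟨j, r, hj, hr⟩ := card_inter_add_one_eq_iff.1 hcard
      have hjX : j ∈ X.1 := (Finset.mem_sdiff.1 (hj ▸ Finset.mem_singleton_self j)).1
      have hrX : r ∉ X.1 := (Finset.mem_sdiff.1 (hr ▸ Finset.mem_singleton_self r)).2
      have hU : X.1 ∩ Y.1 = X.1.erase j := by
        rw [Finset.erase_eq, ← hj, Finset.sdiff_sdiff_self_left]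
      have hrU : r ∈ (X.1.erase j)ᶜ := by simp [hrX]
      rw [hU, hj, hr, Finset.sum_singleton, Finset.sum_singleton, Finset.sum_eq_single_of_mem j hjX,
        Finset.sum_eq_single_of_mem r hrU, if_pos ((swapVertex_eq_iff hjX hrX).2 ⟨hj, hr⟩)]
      · exact fun r' hr' hne => if_neg fun h =>
          hne (Finset.singleton_injective ((hswap j hjX r' hr' h).2.symm.trans hr))
      · exact fun j' hj' hne => Finset.sum_eq_zero fun r' hr' => if_neg fun h =>
          hne (Finset.singleton_injective ((hswap j' hj' r' hr' h).1.symm.trans hj))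
    · exact (Finset.sum_eq_zero fun j hj => Finset.sum_eq_zero fun r hr => if_neg fun h =>
        hcard (card_inter_add_one_eq_iff.2 ⟨j, r, hswap j hj r hr h⟩)).symm

theorem sum_matB_mul (α : Fin N → ℝ) {X : Vertex N k}
    (hne : ∀ j ∈ X.1, (f j).linear (edgeVector f f₀ (X.1.erase j)) ≠ 0) (F : Vertex N k → ℂ) :
    ∑ Y, (matB f f₀ α X Y : ℂ) * F Y = ∑ j ∈ X.1, ∑ r ∈ (X.1.erase j)ᶜ,
      (relSign f f₀ j r (X.1.erase j) * α r : ℝ) * F (swapVertex X j r) := by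
  simp_rw [matB_eq_sum_swapVertex α hne, Complex.ofReal_sum, Finset.sum_mul]
  rw [Finset.sum_comm]
  refine Finset.sum_congr rfl fun j _ => ?_
  rw [Finset.sum_comm]
  refine Finset.sum_congr rfl fun r _ => ?_
  rw [Finset.sum_eq_single_of_mem _ (Finset.mem_univ (swapVertex X j r)), if_pos rfl]
  intro Y _ hY
  rw [if_neg hY.symm, Complex.ofReal_zero, zero_mul]

/-- The coefficient of `ω_X` in front of `1 / ∏_{j ∈ X} s_j f_j`; for signs `s_j` such that
`s_j f_j > 0` this is the constant turning the integrand into a density `expWeight`. -/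
def formCoeff (s : Fin N → ℝ) (f : Fin N → Space k →ᵃ[ℝ] ℝ) (X : Vertex N k) : ℝ :=
  volCoeff f X * ∏ j ∈ X.1, s j

theorem sign_mul_mul_eq {a b p q : ℝ} (ha : a ≠ 0) (h : p * |b| = q * |a|) :
    Real.sign (a * b) * q = p * (b / a) := by
  have hmul : ∀ x : ℝ, Real.sign x * |x| = x := fun x => by
    obtain hx | rfl | hx := lt_trichotomy x 0
    · rw [Real.sign_of_neg hx, abs_of_neg hx, neg_one_mul, neg_neg]
    · simp
    · rw [Real.sign_of_pos hx, abs_of_pos hx, one_mul]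
  have hsq : |a| * |a| = a * a := abs_mul_abs_self a
  rw [mul_div_assoc', eq_div_iff ha]
  refine mul_right_cancel₀ ha ?_
  calc Real.sign (a * b) * q * a * a = Real.sign (a * b) * (q * |a|) * |a| := by
        linear_combination -(Real.sign (a * b) * q) * hsq
    _ = p * (Real.sign (a * b) * |a * b|) := by rw [← h, abs_mul]; ring
    _ = p * b * a := by rw [hmul]; ring

theorem formCoeff_mul_div {s : Fin N → ℝ} {X : Vertex N k} {j r : Fin N} (hj : j ∈ X.1)
    (hr : r ∉ X.1.erase j) (hsj : s j ≠ 0) {e : Space k}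
    (he : ∀ i ∈ X.1.erase j, (f i).linear e = 0) (hje : (f j).linear e ≠ 0) :
    formCoeff s f X * ((s r • f r).linear e / (s j • f j).linear e) =
      Real.sign ((f j).linear e * (f r).linear e) * formCoeff s f (swapVertex X j r) := by
  have hsign := sign_mul_mul_eq hje (volCoeff_swapVertex_mul f hj hr he).symm
  rw [formCoeff, formCoeff, swapVertex_val hj hr, Finset.prod_insert hr,
    ← Finset.mul_prod_erase _ _ hj]
  change _ * (s r * (f r).linear e / (s j * (f j).linear e)) = _
  calc _ = (s r * ∏ i ∈ X.1.erase j, s i) * (volCoeff f X * ((f r).linear e / (f j).linear e)) := by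
        field_simp
    _ = _ := by rw [← hsign]; ring

end ConnectionMatrix

section IntegralVec

variable {N k : ℕ} (o : Orientation ℝ (Space k) (Fin k)) {f : Fin N → Space k →ᵃ[ℝ] ℝ}
  {f₀ : Space k →ₗ[ℝ] ℝ} {α : Fin N → ℝ} {s : Fin N → ℝ} {lam : ℂ}

theorem prod_rpow_mul_inv_prod (hs : ∀ j, |s j| = 1) (α : Fin N → ℝ) (X : Finset (Fin N))
    {z : Space k} (hz : z ∈ polyhedron fun j => s j • f j) :
    (∏ j, |f j z| ^ α j) * (∏ j ∈ X, f j z)⁻¹ =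
      (∏ j ∈ X, s j) * weight (fun j => s j • f j) (lowered α X) z := by
  have hpos : ∀ j, 0 < s j * f j z := hz
  have habs : ∀ j, |f j z| = s j * f j z := fun j => by
    rw [← abs_of_pos (hpos j), abs_mul, hs, one_mul]
  rw [weight_of_mem_polyhedron _ hz, ← Finset.prod_mul_prod_compl X,
    ← Finset.prod_mul_prod_compl X, mul_right_comm, ← mul_assoc, ← Finset.prod_inv_distrib,
    ← Finset.prod_mul_distrib, ← Finset.prod_mul_distrib]
  congr 1
  · refine Finset.prod_congr rfl fun j hj => ?_
    change _ = s j * (s j * f j z) ^ _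
    have hs₀ : s j ≠ 0 := left_ne_zero_of_mul (hpos j).ne'
    have hf₀ : f j z ≠ 0 := right_ne_zero_of_mul (hpos j).ne'
    rw [habs, lowered_of_mem α hj, Real.rpow_sub_one (hpos j).ne']
    field_simp
  · refine Finset.prod_congr rfl fun j hj => ?_
    rw [habs, lowered_of_notMem α (Finset.mem_compl.1 hj)]
    rfl

theorem integrand_eq_formCoeff_mul_expWeight (hs : ∀ j, |s j| = 1) (X : Vertex N k)
    {z : Space k} (hz : z ∈ polyhedron fun j => s j • f j) :
    integrand o f f₀ α X lam z =
      formCoeff s f X * expWeight (fun j => s j • f j) f₀ (lowered α X.1) lam z := by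
  rw [integrand, orientedCoeff_vertexForm, ← mul_assoc, prod_rpow_mul_inv_prod hs α X.1 hz,
    expWeight, formCoeff]
  push_cast
  ring

theorem integralVec_eq_formCoeff_mul_integral (hs : ∀ j, |s j| = 1) (X : Vertex N k) :
    integralVec o f f₀ α (polyhedron fun j => s j • f j) lam X =
      formCoeff s f X * ∫ z, expWeight (fun j => s j • f j) f₀ (lowered α X.1) lam z := by
  have hcongr := setIntegral_congr_fun (μ := volume)
    (isOpen_polyhedron fun j => s j • f j).measurableSet fun _ hz =>
      integrand_eq_formCoeff_mul_expWeight (f₀ := f₀) (α := α) (lam := lam) o hs X hz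
  rw [integralVec, hcongr, integral_const_mul,
    setIntegral_eq_integral_of_forall_compl_eq_zero fun z hz => ?_]
  rw [expWeight, weight_of_notMem_polyhedron _ hz, Complex.ofReal_zero, mul_zero]

theorem integrableOn_integrand (hs : ∀ j, |s j| = 1)
    (hf₀ : Dominates f₀ fun j => s j • f j) {X : Vertex N k} (hX : IsSimpleVertex f X.1)
    (hα : ∀ j, 0 < α j) (hlam : 0 < lam.re) :
    IntegrableOn (integrand o f f₀ α X lam) (polyhedron fun j => s j • f j) := by
  have hs₀ : ∀ j, s j ≠ 0 := fun j h => by simpa [h] using hs j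
  refine IntegrableOn.congr_fun (Integrable.integrableOn ?_) (fun z hz =>
    (integrand_eq_formCoeff_mul_expWeight o hs X hz).symm) (isOpen_polyhedron _).measurableSet
  exact (integrable_expWeight_lowered volume hf₀ (hX.smul hs₀) hα subset_rfl hlam).const_mul _

theorem hasDerivAt_integralVec_apply (hs : ∀ j, |s j| = 1)
    (hf₀ : Dominates f₀ fun j => s j • f j) {X : Vertex N k} (hX : ∃ z, flat f X.1 = {z})
    (hedge : ∀ U : Finset (Fin N), U.card + 1 = k → ∃ z ∈ flat f U, ∃ w ∈ flat f U, f₀ z ≠ f₀ w)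
    (hα : ∀ j, 0 < α j) (hlam : 0 < lam.re) :
    HasDerivAt (fun l => integralVec o f f₀ α (polyhedron fun j => s j • f j) l X)
      (-(f₀ (vertexPoint f X) * integralVec o f f₀ α (polyhedron fun j => s j • f j) lam X +
        lam⁻¹ * ∑ Y, matB f f₀ α X Y *
          integralVec o f f₀ α (polyhedron fun j => s j • f j) lam Y)) lam := by
  have hs₀ : ∀ j, s j ≠ 0 := fun j h => by simpa [h] using hs j
  have hsimple := isSimpleVertex_of_flat_eq_singleton X hX
  set e : Fin N → Space k := fun j => edgeVector f f₀ (X.1.erase j)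
  have he : ∀ j ∈ X.1, (∀ i ∈ X.1.erase j, (f i).linear (e j) = 0) ∧ f₀ (e j) = 1 := fun j hj =>
    edgeVector_spec hsimple (hedge _ (by rw [Finset.card_erase_add_one hj, X.2]))
  have hne : ∀ j ∈ X.1, (f j).linear (e j) ≠ 0 := fun j hj =>
    hsimple.linear_ne_zero (he j hj).1 fun h => by simpa [h] using (he j hj).2
  have hderiv := hasDerivAt_integral_expWeight_lowered volume hf₀ (hsimple.smul hs₀) hα hlam
    (p := vertexPoint f X) (e := e) (fun j hj => mul_eq_zero_of_right _ (apply_vertexPoint hX hj))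
    (fun j hj i hi => mul_eq_zero_of_right _ ((he j hj).1 i hi)) fun j hj => (he j hj).2
  rw [sum_matB_mul α hne]
  simp only [integralVec_eq_formCoeff_mul_integral o hs]
  refine (hderiv.const_mul (formCoeff s f X : ℂ)).congr_deriv ?_
  rw [mul_neg, mul_add, mul_left_comm, mul_left_comm _ lam⁻¹, Finset.mul_sum]
  congr 3
  refine Finset.sum_congr rfl fun j hj => ?_
  rw [Finset.mul_sum]
  refine Finset.sum_congr rfl fun r hr => ?_
  have hr := Finset.mem_compl.1 hr
  have hcoeff := formCoeff_mul_div hj hr (hs₀ j) (he j hj).1 (hne j hj)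
  rw [swapVertex_val hj hr, ← mul_assoc, ← mul_assoc, ← Complex.ofReal_mul, ← Complex.ofReal_mul,
    relSign, mul_right_comm, ← hcoeff]
  congr 2
  ring

theorem mainTheorem7_general (hvertex : ∀ X : Finset (Fin N), X.card = k → ∃ z, flat f X = {z})
    (hα : ∀ j, 0 < α j)
    (hedge : ∀ U : Finset (Fin N), U.card + 1 = k → ∃ z ∈ flat f U, ∃ w ∈ flat f U, f₀ z ≠ f₀ w)
    {Δ : Set (Space k)} (hΔ : Δ ∈ domainsPlus f f₀) (hlam : 0 < lam.re) :
    (∀ X : Vertex N k, IntegrableOn (integrand o f f₀ α X lam) Δ) ∧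
      HasDerivAt (integralVec o f f₀ α Δ)
        (-(((matA f f₀).map Complex.ofReal + lam⁻¹ • (matB f f₀ α).map Complex.ofReal).mulVec
          (integralVec o f f₀ α Δ lam))) lam := by
  obtain ⟨s, hs, rfl, hne⟩ := exists_eq_polyhedron_of_mem_domains hΔ.1
  have hs₀ : ∀ j, s j ≠ 0 := fun j h => by simpa [h] using hs j
  have hsimple : ∀ X : Vertex N k, IsSimpleVertex f X.1 := fun X =>
    isSimpleVertex_of_flat_eq_singleton X (hvertex X.1 X.2)
  have hdom : Vertex N k → Dominates f₀ fun j => s j • f j := fun X => by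
    have hN : k ≤ N := by simpa [X.2] using X.1.card_le_univ
    refine dominates_of_bddBelow hne hΔ.2 fun v hv => ?_
    obtain ⟨w, hw, hw₀⟩ := exists_form_ne_zero hN hsimple hedge hv
    exact ⟨w, fun j hj => mul_eq_zero_of_right _
      (hw j ((mul_eq_zero.1 hj).resolve_left (hs₀ j))), hw₀⟩
  refine ⟨fun X => integrableOn_integrand o hs (hdom X) (hsimple X) hα hlam,
    hasDerivAt_pi.2 fun X => ?_⟩
  have hderiv := hasDerivAt_integralVec_apply o hs (hdom X) (hvertex X.1 X.2) hedge hα hlam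
  refine hderiv.congr_deriv ?_
  rw [Matrix.add_mulVec, Matrix.smul_mulVec, matA, Matrix.diagonal_map Complex.ofReal_zero,
    Pi.neg_apply, Pi.add_apply, Matrix.mulVec_diagonal]
  rfl

end IntegralVec

end HyperplaneIntegrals

end

theorem mainTheorem7 {N k : ℕ} (hk : 1 ≤ k) (hN : k ≤ N)
    (o : Orientation ℝ (HyperplaneIntegrals.Space k) (Fin k))
    (f : Fin N → HyperplaneIntegrals.Space k →ᵃ[ℝ] ℝ)
    (hf : HyperplaneIntegrals.IsGeneric f)
    (α : Fin N → ℝ) (hα : ∀ j, 0 < α j)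
    (f₀ : HyperplaneIntegrals.Space k →ₗ[ℝ] ℝ)
    (hf₀ : HyperplaneIntegrals.IsGenericForm f f₀)
    (Δ : Set (HyperplaneIntegrals.Space k))
    (hΔ : Δ ∈ HyperplaneIntegrals.domainsPlus f f₀)
    (lam : ℂ) (hlam : 0 < lam.re) :
    (∀ X : HyperplaneIntegrals.Vertex N k,
      MeasureTheory.IntegrableOn (HyperplaneIntegrals.integrand o f f₀ α X lam) Δ) ∧
    HasDerivAt (HyperplaneIntegrals.integralVec o f f₀ α Δ)
      (-(((HyperplaneIntegrals.matA f f₀).map Complex.ofReal +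
          lam⁻¹ • (HyperplaneIntegrals.matB f f₀ α).map Complex.ofReal).mulVec
        (HyperplaneIntegrals.integralVec o f f₀ α Δ lam))) lam :=
  HyperplaneIntegrals.mainTheorem7_general o hf.vertex hα hf₀.nonconstant hΔ hlam
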